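/- **Theorem (Kerdock-type spectral support).** Let $m\ge 2$ be even and $G=\mathbb F_2^m$. Call a set $\mathcal Q$ of $2^{m-1}$ quadratic forms on $G$ a *Kerdock set* if $Q+Q'$ is nondegenerate (its polar bilinear form is nondegenerate) for all distinct $Q,Q'\in\mathcal Q$. For a Kerdock set $\mathcal Q$ put $$S_K=\{\,Q+\ell_a+b \;:\; Q\in\mathcal Q,\ a\in G,\ b\in\mathbb F_2\,\}\subseteq \mathbb F_2^{G}\cong\mathbb F_2^{2^m},\qquad \ell_a(x)=a\cdot x .$$ For $S\subseteq \mathbb F_2^{G}$ let $\mathcal C(S)\subseteq \mathbb C^{\mathbb F_2^{G}}$ be the Fourier-support code, i.e. the span of the vectors $|s\rangle_F=2^{-2^m/2}\sum_{x}(-1)^{s\cdot x}|x\rangle$, $s\in S$. For $\omega\in\mathbb F_2^{G}$ let $Z^\omega|x\rangle=(-1)^{\omega\cdot x}|x\rangle$; the $t$-local phase errors are the $Z^\omega$ with $\omega$ of Hamming weight at most $t$. A code exactly corrects a family of errors if a single recovery channel restores, up to a scalar depending on the error only, every density operator supported on the code after any error of the family. Then: 1. Kerdock sets exist on $G$, and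 one can be chosen to contain the zero form (so that all its other members are nondegenerate). 2. For every Kerdock set $\mathcal Q$ on $G$, $|S_K|=2^{2m}$ and the minimum Hamming distance of $S_K$ is $d(S_K)=2^{m-1}-2^{m/2-1}$. Hence $\mathcal C(S_K)$ has dimension $2^{2m}$, and it exactly corrects all $t$-local phase errors whenever $2t+1\le 2^{m-1}-2^{m/2-1}$. 3. In comparison, the first-order Reed–Muller code $\mathrm{RM}(1,m)=\{\ell_a+b\}$ has parameters $[2^m,\,m+1,\,2^{m-1}]$ and only $2^{m+1}$ words, so that $\mathcal C(\mathrm{RM}(1,m))$ has dimension $2^{m+1}$; it exactly corrects all $t$-local phase errors whenever $2t+1\le 2^{m-1}$. -/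

import Mathlib

open scoped Matrix

noncomputable section

/-! ### Codes in the Hamming space of binary words indexed by a finite type -/

/-- `d` is the minimum Hamming distance of the code `S`: it is attained by two distinct words of
`S`, and any two distinct words of `S` have distance at least `d`. -/
def IsMinDist {ι : Type*} [Fintype ι] (S : Set (ι → ZMod 2)) (d : ℕ) : Prop :=
  IsLeast {k : ℕ | ∃ s₁ ∈ S, ∃ s₂ ∈ S, s₁ ≠ s₂ ∧ hammingDist s₁ s₂ = k} d

/-! ### Kerdock sets and the associated codes -/

/-- A quadratic form over the field with two elements is nondegenerate if its polar form
`(x, y) ↦ Q (x + y) - Q x - Q y` is a nondegenerate bilinear form. -/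
def IsNondegQuadratic {m : ℕ} (Q : QuadraticForm (ZMod 2) (Fin m → ZMod 2)) : Prop :=
  (QuadraticMap.polarBilin Q).Nondegenerate

/-- A Kerdock set: `2 ^ (m - 1)` quadratic forms on the space of binary vectors of length `m`, the
sum of any two distinct ones being nondegenerate. -/
def IsKerdockSet {m : ℕ} (𝒬 : Set (QuadraticForm (ZMod 2) (Fin m → ZMod 2))) : Prop :=
  𝒬.ncard = 2 ^ (m - 1) ∧ ∀ Q ∈ 𝒬, ∀ Q' ∈ 𝒬, Q ≠ Q' → IsNondegQuadratic (Q + Q')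

/-- The set of Boolean functions `x ↦ Q x + a ⬝ x + b` with `Q` in the given set of quadratic
forms, `a` a binary vector and `b` a bit. A Boolean function on the binary vectors of length `m` is
a word of length `2 ^ m`. -/
def kerdockSupport {m : ℕ} (𝒬 : Set (QuadraticForm (ZMod 2) (Fin m → ZMod 2))) :
    Set ((Fin m → ZMod 2) → ZMod 2) :=
  {f | ∃ Q ∈ 𝒬, ∃ (a : Fin m → ZMod 2) (b : ZMod 2), f = fun x => Q x + a ⬝ᵥ x + b}

/-- The first-order binary Reed-Muller code of length `2 ^ m`: the linear code spanned by the
constant function `1` and the `m` coordinate functions. -/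
def reedMullerOne (m : ℕ) : Submodule (ZMod 2) ((Fin m → ZMod 2) → ZMod 2) :=
  Submodule.span (ZMod 2)
    (insert (fun _ => 1) (Set.range fun (i : Fin m) (x : Fin m → ZMod 2) => x i))

/-! ### Fourier-support codes and phase errors -/

/-- The Hilbert space of qubits indexed by `ι`, with the binary words `x : ι → ZMod 2` as labels of
the computational basis. -/
abbrev QubitSpace (ι : Type*) [Fintype ι] [DecidableEq ι] : Type _ :=
  EuclideanSpace ℂ (ι → ZMod 2)

/-- The Fourier basis vector labelled by `s`: its coordinate at `x` is the value of the character
of `s` at `x` (the sign `(-1) ^ (s ⬝ x)`) divided by the square root of the dimension. -/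
def fourierKet {ι : Type*} [Fintype ι] [DecidableEq ι] (s : ι → ZMod 2) : QubitSpace ι :=
  WithLp.toLp 2 fun x =>
    ((1 / Real.sqrt (2 ^ Fintype.card ι) : ℝ) : ℂ) * ZMod.stdAddChar (s ⬝ᵥ x)

/-- The Fourier-support code with spectral support `S`. -/
def fourierCode {ι : Type*} [Fintype ι] [DecidableEq ι] (S : Set (ι → ZMod 2)) :
    Submodule ℂ (QubitSpace ι) :=
  Submodule.span ℂ (fourierKet '' S)

/-- The diagonal phase operator of `ω`, multiplying the computational basis vector of label `x` by
the sign `(-1) ^ (ω ⬝ x)`. -/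
def phaseOp {ι : Type*} [Fintype ι] [DecidableEq ι] (ω : ι → ZMod 2) :
    QubitSpace ι →ₗ[ℂ] QubitSpace ι where
  toFun v := WithLp.toLp 2 fun x => ZMod.stdAddChar (ω ⬝ᵥ x) * v x
  map_add' v w := by ext x; simp [mul_add]
  map_smul' c v := by ext x; simp [mul_left_comm]

/-- The family of `t`-local phase errors: the phase operators of the words of weight at most `t`. -/
def localPhaseErrors (ι : Type*) [Fintype ι] [DecidableEq ι] (t : ℕ) :
    Set (QubitSpace ι →ₗ[ℂ] QubitSpace ι) :=
  {E | ∃ ω : ι → ZMod 2, hammingNorm ω ≤ t ∧ E = phaseOp ω}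

/-- The quantum code `C` exactly corrects the family of errors `𝓔`: there is one recovery operation
(a trace-preserving quantum channel, with Kraus operators `R i`) which, after any error of the
family, restores every (unnormalised) density operator supported on `C`, up to a scalar that
depends on the error only. -/
def ExactlyCorrects {H : Type*} [NormedAddCommGroup H] [InnerProductSpace ℂ H]
    [FiniteDimensional ℂ H] (C : Submodule ℂ H) (𝓔 : Set (H →ₗ[ℂ] H)) : Prop :=
  ∃ (r : ℕ) (R : Fin r → (H →ₗ[ℂ] H)),
    ∑ i, LinearMap.adjoint (R i) * R i = 1 ∧
    ∀ E ∈ 𝓔, ∃ c : ℂ, ∀ ρ : H →ₗ[ℂ] H, ρ.IsPositive → LinearMap.range ρ ≤ C →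
      ∑ i, R i * (E * ρ * LinearMap.adjoint E) * LinearMap.adjoint (R i) = c • ρ

end

/-! ### Fourier-support codes and recovery by classical decoding -/

section FourierSupportCodes

variable {ι : Type*} [Fintype ι] [DecidableEq ι]

/-! The Fourier kets are orthonormal, so the dimension of the code is the size of its support, and a
phase error `ω` translates the Fourier label `s` to `s + ω`. Correcting phase errors is therefore
classical decoding of the support: if `2 * t + 1 ≤ d`, the label `s + ω` determines `ω`, which can
be measured and undone (`exactlyCorrects_of_decoder`).

What remains is classical. The sum of two distinct words of the Kerdock support is either a nonzero
affine function, of weight at least `2 ^ (m - 1)`, or a nondegenerate quadratic form plus an affine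
function. The latter is bent: its sign sum squares to `2 ^ m` (`signSum_quadratic_sq`), so its
weight is `2 ^ (m - 1) ± 2 ^ (m / 2 - 1)`.

For existence, alternating forms indexed by the field `K` of order `2 ^ (m - 1)` are built on `K ×
𝔽₂` from the trace. The sum of two of them is nondegenerate because the degree `m - 1` is odd
(`eq_zero_of_kerdockBilin_add_eq_zero`). -/

theorem zmod_two_add_self_fun {α : Type*} (f : α → ZMod 2) : f + f = 0 := by
  funext x; exact CharTwo.add_self_eq_zero (f x)

theorem zmod_two_add_add_cancel {α : Type*} (f g : α → ZMod 2) : f + g + g = f := by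
  rw [add_assoc, zmod_two_add_self_fun, add_zero]

theorem sum_stdAddChar_dotProduct (s : ι → ZMod 2) :
    ∑ x : ι → ZMod 2, (ZMod.stdAddChar (s ⬝ᵥ x) : ℂ) =
      if s = 0 then 2 ^ Fintype.card ι else 0 := by
  split_ifs with h
  · subst h; simp
  · obtain ⟨i, hi⟩ := Function.ne_iff.1 h
    let L : (ι → ZMod 2) →+ ZMod 2 := (dotProductBilin (ZMod 2) (ZMod 2) s).toAddMonoidHom
    have key := AddChar.sum_eq_zero_iff_ne_zero (ψ := (ZMod.stdAddChar (N := 2)).compAddMonoidHom L)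
    refine key.2 fun h0 => hi ?_
    have h1 := DFunLike.congr_fun h0 (Pi.single i 1)
    have h2 : (ZMod.stdAddChar (N := 2)) (s i) = 1 := by simpa [L] using h1
    rw [← AddChar.map_zero_eq_one (ZMod.stdAddChar (N := 2))] at h2
    exact ZMod.injective_stdAddChar h2

theorem conj_stdAddChar_two (a : ZMod 2) :
    starRingEnd ℂ (ZMod.stdAddChar a) = ZMod.stdAddChar a := by
  rw [← AddChar.map_neg_eq_conj, CharTwo.neg_eq]

theorem fourierKet_apply (s x : ι → ZMod 2) :
    fourierKet s x =
      ((1 / Real.sqrt (2 ^ Fintype.card ι) : ℝ) : ℂ) * ZMod.stdAddChar (s ⬝ᵥ x) := rfl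

theorem inner_fourierKet (s s' : ι → ZMod 2) :
    inner ℂ (fourierKet s) (fourierKet s') = if s = s' then (1 : ℂ) else 0 := by
  have h : ∀ x, inner ℂ (fourierKet s x) (fourierKet s' x) =
      (1 / 2 ^ Fintype.card ι : ℂ) * ZMod.stdAddChar ((s + s') ⬝ᵥ x) := by
    intro x
    have h2 : (((1 / Real.sqrt (2 ^ Fintype.card ι) : ℝ) : ℂ)) *
        ((1 / Real.sqrt (2 ^ Fintype.card ι) : ℝ) : ℂ) = 1 / 2 ^ Fintype.card ι := by
      rw [← Complex.ofReal_mul, div_mul_div_comm, Real.mul_self_sqrt (by positivity)]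
      simp
    rw [RCLike.inner_apply, fourierKet_apply, fourierKet_apply, map_mul, conj_stdAddChar_two,
      Complex.conj_ofReal, add_dotProduct, AddChar.map_add_eq_mul, ← h2]
    ring
  rw [PiLp.inner_apply, Finset.sum_congr rfl fun x _ => h x, ← Finset.mul_sum,
    sum_stdAddChar_dotProduct]
  have hs : s + s' = 0 ↔ s = s' := by
    rw [← add_left_inj s', zmod_two_add_add_cancel, zero_add]
  simp [hs]

theorem orthonormal_fourierKet : Orthonormal ℂ (fourierKet : (ι → ZMod 2) → QubitSpace ι) := by
  rw [orthonormal_iff_ite]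
  exact fun s s' => inner_fourierKet s s'

/-- The Fourier basis of the space of qubits. -/
noncomputable def qubitFourierBasis (ι : Type*) [Fintype ι] [DecidableEq ι] :
    Module.Basis (ι → ZMod 2) ℂ (QubitSpace ι) :=
  basisOfOrthonormalOfCardEqFinrank orthonormal_fourierKet (by simp)

@[simp] theorem qubitFourierBasis_apply (s : ι → ZMod 2) :
    qubitFourierBasis ι s = fourierKet s := by
  simp [qubitFourierBasis]

theorem finrank_fourierCode (S : Set (ι → ZMod 2)) :
    Module.finrank ℂ (fourierCode S) = S.ncard := by
  classical
  have hli := orthonormal_fourierKet (ι := ι).linearIndependent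
  have := finrank_span_set_eq_card (R := ℂ) (s := fourierKet '' S)
    (hli.linearIndepOn_id.mono (Set.image_subset_range _ _))
  rw [fourierCode, this, ← Set.ncard_eq_toFinset_card',
    Set.ncard_image_of_injective _ hli.injective]

theorem phaseOp_fourierKet (ω s : ι → ZMod 2) : phaseOp ω (fourierKet s) = fourierKet (s + ω) := by
  ext x
  change ZMod.stdAddChar (ω ⬝ᵥ x) * fourierKet s x = _
  rw [fourierKet_apply, fourierKet_apply, add_dotProduct, AddChar.map_add_eq_mul]
  ring

/-- The Kraus operator of the recovery for a decoding function `dec`: restrict to the Fourier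
labels whose decoded error is `ω`, then undo the phase error `ω`. -/
noncomputable def decodingKraus (dec : (ι → ZMod 2) → (ι → ZMod 2)) (ω : ι → ZMod 2) :
    QubitSpace ι →ₗ[ℂ] QubitSpace ι :=
  (qubitFourierBasis ι).constr ℂ fun y => if dec y = ω then fourierKet (y + ω) else 0

theorem decodingKraus_fourierKet (dec : (ι → ZMod 2) → (ι → ZMod 2)) (ω y : ι → ZMod 2) :
    decodingKraus dec ω (fourierKet y) = if dec y = ω then fourierKet (y + ω) else 0 := by
  rw [decodingKraus, ← qubitFourierBasis_apply, Module.Basis.constr_basis]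

/-- Each label `y` survives in exactly one Kraus operator, that of `dec y`, and there the labels are
merely translated, which keeps them orthonormal. -/
theorem sum_adjoint_decodingKraus (dec : (ι → ZMod 2) → (ι → ZMod 2)) :
    ∑ ω, LinearMap.adjoint (decodingKraus dec ω) * decodingKraus dec ω = 1 := by
  refine (qubitFourierBasis ι).ext fun y => ?_
  refine InnerProductSpace.ext_inner_left_basis (𝕜 := ℂ) (qubitFourierBasis ι) fun x => ?_
  simp only [qubitFourierBasis_apply, LinearMap.sum_apply, Module.End.mul_apply, Module.End.one_apply,
    inner_sum, LinearMap.adjoint_inner_right, decodingKraus_fourierKet]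
  rw [Finset.sum_eq_single (dec y)]
  · rw [if_pos rfl, inner_fourierKet]
    split_ifs with h1 h2 h2
    · rw [h2, inner_fourierKet, if_pos rfl]
    · rw [inner_fourierKet, if_neg (by simpa using h2)]
    · exact absurd (by rw [h2]) h1
    · simp
  · intro ω _ hω
    rw [if_neg (Ne.symm hω), inner_zero_right]
  · simp

theorem decodingKraus_phaseOp_of_mem {S : Set (ι → ZMod 2)} {dec : (ι → ZMod 2) → (ι → ZMod 2)}
    {ω : ι → ZMod 2} (hdec : ∀ s ∈ S, dec (s + ω) = ω) (ω' : ι → ZMod 2) {v : QubitSpace ι}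
    (hv : v ∈ fourierCode S) :
    decodingKraus dec ω' (phaseOp ω v) = if ω = ω' then v else 0 := by
  induction hv using Submodule.span_induction with
  | mem v hv =>
    obtain ⟨s, hs, rfl⟩ := hv
    rw [phaseOp_fourierKet, decodingKraus_fourierKet, hdec s hs]
    split_ifs with h
    · rw [← h, zmod_two_add_add_cancel]
    · rfl
  | zero => simp
  | add v w _ _ hv hw => rw [map_add, map_add, hv, hw]; split_ifs <;> simp
  | smul c v _ hv => rw [map_smul, map_smul, hv]; split_ifs <;> simp

theorem exactlyCorrects_of_decoder {S W : Set (ι → ZMod 2)} {dec : (ι → ZMod 2) → (ι → ZMod 2)}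
    (hdec : ∀ ω ∈ W, ∀ s ∈ S, dec (s + ω) = ω) :
    ExactlyCorrects (fourierCode S) (phaseOp '' W) := by
  let e := (Fintype.equivFin (ι → ZMod 2)).symm
  refine ⟨_, fun i => decodingKraus dec (e i), ?_, ?_⟩
  · rw [← sum_adjoint_decodingKraus dec]
    exact Equiv.sum_comp e fun ω =>
      LinearMap.adjoint (decodingKraus dec ω) * decodingKraus dec ω
  · rintro _ ⟨ω, hω, rfl⟩
    refine ⟨1, fun ρ hρ hC => ?_⟩
    have hρ' : LinearMap.adjoint ρ = ρ :=
      (LinearMap.isSymmetric_iff_isSelfAdjoint ρ).1 hρ.isSymmetric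
    -- On the corrupted code only the Kraus operator of the true error acts, and it acts as the
    -- exact inverse. Self-adjointness of `ρ` carries this over to the right-hand factor.
    have hT : ∀ ω', decodingKraus dec ω' * phaseOp ω * ρ = if ω = ω' then ρ else 0 := by
      intro ω'
      ext1 v
      have := decodingKraus_phaseOp_of_mem (hdec ω hω) ω' (hC ⟨v, rfl⟩)
      simp only [Module.End.mul_apply, this]
      split_ifs <;> rfl
    have hterm : ∀ ω', decodingKraus dec ω' * (phaseOp ω * ρ * LinearMap.adjoint (phaseOp ω)) *
        LinearMap.adjoint (decodingKraus dec ω') = if ω = ω' then ρ else 0 := by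
      intro ω'
      have h1 : decodingKraus dec ω' * (phaseOp ω * ρ * LinearMap.adjoint (phaseOp ω)) *
          LinearMap.adjoint (decodingKraus dec ω') =
          (decodingKraus dec ω' * phaseOp ω * ρ) *
            LinearMap.adjoint (decodingKraus dec ω' * phaseOp ω) := by
        rw [show LinearMap.adjoint (decodingKraus dec ω' * phaseOp ω) =
          LinearMap.adjoint (phaseOp ω) * LinearMap.adjoint (decodingKraus dec ω') from
          LinearMap.adjoint_comp _ _]
        simp only [mul_assoc]
      have h2 : ρ * LinearMap.adjoint (decodingKraus dec ω' * phaseOp ω) =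
          LinearMap.adjoint (decodingKraus dec ω' * phaseOp ω * ρ) := by
        conv_lhs => rw [← hρ']
        exact (LinearMap.adjoint_comp _ _).symm
      rw [h1, hT]
      split_ifs with h
      · rw [h2, hT, if_pos h, hρ']
      · rw [zero_mul]
    rw [one_smul, Equiv.sum_comp e fun ω' => decodingKraus dec ω' *
      (phaseOp ω * ρ * LinearMap.adjoint (phaseOp ω)) * LinearMap.adjoint (decodingKraus dec ω'),
      Finset.sum_congr rfl fun ω' _ => hterm ω']
    simp

omit [DecidableEq ι] in
theorem eq_of_add_eq_add_of_hammingNorm_le {S : Set (ι → ZMod 2)} {d t : ℕ}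
    (hS : ∀ s₁ ∈ S, ∀ s₂ ∈ S, s₁ ≠ s₂ → d ≤ hammingDist s₁ s₂) (ht : 2 * t + 1 ≤ d)
    {s₁ s₂ ω₁ ω₂ : ι → ZMod 2} (hs₁ : s₁ ∈ S) (hs₂ : s₂ ∈ S) (hω₁ : hammingNorm ω₁ ≤ t)
    (hω₂ : hammingNorm ω₂ ≤ t) (h : s₁ + ω₁ = s₂ + ω₂) : ω₁ = ω₂ := by
  by_cases hs : s₁ = s₂
  · rwa [hs, add_right_inj] at h
  · have h1 := hS _ hs₁ _ hs₂ hs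
    have h2 := hammingDist_triangle s₁ (s₁ + ω₁) s₂
    have h3 : ∀ s ω : ι → ZMod 2, hammingDist s (s + ω) = hammingNorm ω := fun s ω => by
      rw [hammingDist_eq_hammingNorm, neg_add_cancel_left]
    rw [h3, h, hammingDist_comm (s₂ + ω₂), h3] at h2
    omega

theorem exactlyCorrects_localPhaseErrors {S : Set (ι → ZMod 2)} {d t : ℕ} (hS : IsMinDist S d)
    (ht : 2 * t + 1 ≤ d) : ExactlyCorrects (fourierCode S) (localPhaseErrors ι t) := by
  classical
  have hd : ∀ s₁ ∈ S, ∀ s₂ ∈ S, s₁ ≠ s₂ → d ≤ hammingDist s₁ s₂ := fun s₁ h₁ s₂ h₂ h =>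
    hS.2 ⟨s₁, h₁, s₂, h₂, h, rfl⟩
  -- Labels outside all balls of radius `t` get the value `0`: any value would do, since trace
  -- preservation holds for every total decoder.
  let dec : (ι → ZMod 2) → (ι → ZMod 2) := fun y =>
    if h : ∃ ω, hammingNorm ω ≤ t ∧ ∃ s ∈ S, s + ω = y then h.choose else 0
  have hdec : ∀ ω ∈ {ω : ι → ZMod 2 | hammingNorm ω ≤ t}, ∀ s ∈ S, dec (s + ω) = ω := by
    intro ω hω s hs
    have h : ∃ ω', hammingNorm ω' ≤ t ∧ ∃ s' ∈ S, s' + ω' = s + ω := ⟨ω, hω, s, hs, rfl⟩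
    obtain ⟨h1, s', hs', h2⟩ := h.choose_spec
    simp only [dec, dif_pos h]
    exact eq_of_add_eq_add_of_hammingNorm_le hd ht hs' hs h1 hω h2
  convert exactlyCorrects_of_decoder hdec using 1
  ext E
  simp [localPhaseErrors, eq_comm]

end FourierSupportCodes

/-! ### Sign sums of Boolean functions -/

section SignSums

/-- The nontrivial additive character of the field with two elements, with integer values. -/
noncomputable def bitSign : AddChar (ZMod 2) ℤ :=
  AddChar.zmodChar 2 (by norm_num : (-1 : ℤ) ^ 2 = 1)

theorem bitSign_one : bitSign 1 = -1 := by
  simpa [bitSign] using AddChar.zmodChar_apply' (by norm_num : (-1 : ℤ) ^ 2 = 1) 1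

theorem bitSign_eq_ite (b : ZMod 2) : bitSign b = if b ≠ 0 then -1 else 1 := by
  fin_cases b
  · exact AddChar.map_zero_eq_one bitSign
  · exact bitSign_one

theorem bitSign_eq_or (b : ZMod 2) : bitSign b = 1 ∨ bitSign b = -1 := by
  rw [bitSign_eq_ite]; split_ifs <;> simp

/-- The sum of the signs of a Boolean function. -/
noncomputable def signSum {X : Type*} [Fintype X] (f : X → ZMod 2) : ℤ := ∑ x, bitSign (f x)

variable {X : Type*} [Fintype X]

theorem signSum_eq_card_sub (f : X → ZMod 2) :
    signSum f = Fintype.card X - 2 * hammingNorm f := by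
  have h : ∀ x, bitSign (f x) = 1 - 2 * if f x ≠ 0 then 1 else 0 := fun x => by
    rw [bitSign_eq_ite]; split_ifs <;> norm_num
  rw [signSum, Finset.sum_congr rfl fun x _ => h x, Finset.sum_sub_distrib, ← Finset.mul_sum,
    Finset.sum_boole]
  simp [hammingNorm]

theorem signSum_add_const (f : X → ZMod 2) (b : ZMod 2) :
    signSum (fun x => f x + b) = bitSign b * signSum f := by
  simp_rw [signSum, AddChar.map_add_eq_mul, Finset.mul_sum, mul_comm]

theorem signSum_addMonoidHom {V : Type*} [Fintype V] [AddCommGroup V] {L : V →+ ZMod 2}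
    (hL : L ≠ 0) : signSum L = 0 := by
  refine (AddChar.sum_eq_zero_iff_ne_zero (ψ := bitSign.compAddMonoidHom L)).2 fun h => hL ?_
  ext x
  have hx : bitSign (L x) = 1 := DFunLike.congr_fun h x
  rw [bitSign_eq_ite] at hx
  simpa using hx

end SignSums

/-! ### Bentness of nondegenerate quadratic forms and weights of words -/

section Bent

variable {m : ℕ}

theorem dotProductBilin_ne_zero {a : Fin m → ZMod 2} (ha : a ≠ 0) :
    (dotProductBilin (ZMod 2) (ZMod 2) a).toAddMonoidHom ≠ 0 := by
  obtain ⟨i, hi⟩ := Function.ne_iff.1 ha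
  intro h
  exact hi (by simpa using DFunLike.congr_fun h (Pi.single i 1))

theorem signSum_dotProduct {a : Fin m → ZMod 2} (ha : a ≠ 0) :
    signSum (fun x => a ⬝ᵥ x) = 0 :=
  signSum_addMonoidHom (dotProductBilin_ne_zero ha)

/-- In the squared sum, substitute `y + x` for the second variable: the sign becomes a character in
`x` given by the polar form at `y`, times a factor free of `x`. By nondegeneracy only `y = 0`
survives. -/
theorem signSum_quadratic_sq {Q : QuadraticForm (ZMod 2) (Fin m → ZMod 2)}
    (hQ : IsNondegQuadratic Q) (a : Fin m → ZMod 2) :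
    signSum (fun x => Q x + a ⬝ᵥ x) ^ 2 = 2 ^ m := by
  have h1 : signSum (fun x => Q x + a ⬝ᵥ x) ^ 2 =
      ∑ y, ∑ x, bitSign (Q.polarBilin y x) * bitSign (Q y + a ⬝ᵥ y) := by
    rw [sq, signSum, Finset.sum_mul_sum, Finset.sum_comm (s := Finset.univ (α := Fin m → ZMod 2))
      (f := fun y x => bitSign (Q.polarBilin y x) * bitSign (Q y + a ⬝ᵥ y))]
    refine Finset.sum_congr rfl fun x _ => ?_
    rw [← Equiv.sum_comp (Equiv.addRight x)]
    refine Finset.sum_congr rfl fun y _ => ?_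
    rw [← AddChar.map_add_eq_mul, ← AddChar.map_add_eq_mul]
    congr 1
    rw [Equiv.coe_addRight, QuadraticMap.polarBilin_apply_apply, QuadraticMap.polar,
      dotProduct_add]
    linear_combination (Q x + a ⬝ᵥ x) * CharTwo.two_eq_zero (R := ZMod 2)
  rw [h1]
  have h2 : ∀ y, ∑ x, bitSign (Q.polarBilin y x) * bitSign (Q y + a ⬝ᵥ y) =
      if y = 0 then 2 ^ m else 0 := by
    intro y
    rw [← Finset.sum_mul]
    split_ifs with hy
    · subst hy; simp
    · have : (Q.polarBilin y).toAddMonoidHom ≠ 0 := by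
        intro h
        refine hy (hQ.1 y fun x => ?_)
        exact DFunLike.congr_fun h x
      rw [show ∑ x, bitSign (Q.polarBilin y x) = 0 from signSum_addMonoidHom this, zero_mul]
  simp_rw [h2]
  simp

theorem hammingNorm_of_signSum (hm : 1 ≤ m) {f : (Fin m → ZMod 2) → ZMod 2} {k : ℤ}
    (h : signSum f = 2 * k) : (hammingNorm f : ℤ) = 2 ^ (m - 1) - k := by
  have h1 := signSum_eq_card_sub f
  have h2 : (2 : ℤ) ^ m = 2 * 2 ^ (m - 1) := by rw [← pow_succ', Nat.sub_add_cancel hm]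
  simp only [Fintype.card_pi, ZMod.card, Finset.prod_const, Finset.card_univ, Fintype.card_fin,
    Nat.cast_pow, Nat.cast_ofNat] at h1
  linarith

theorem hammingNorm_affine (hm : 1 ≤ m) {a : Fin m → ZMod 2} (ha : a ≠ 0) (b : ZMod 2) :
    hammingNorm (fun x => a ⬝ᵥ x + b) = 2 ^ (m - 1) := by
  have h := hammingNorm_of_signSum hm (f := fun x => a ⬝ᵥ x + b) (k := 0)
    (by rw [signSum_add_const, signSum_dotProduct ha]; simp)
  rw [sub_zero] at h
  exact_mod_cast h

theorem pow_le_hammingNorm_affine (hm : 1 ≤ m) {a : Fin m → ZMod 2} {b : ZMod 2}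
    (hab : (fun x : Fin m → ZMod 2 => a ⬝ᵥ x + b) ≠ 0) :
    2 ^ (m - 1) ≤ hammingNorm (fun x => a ⬝ᵥ x + b) := by
  by_cases ha : a = 0
  · subst ha
    have hb : b ≠ 0 := fun hb => hab (by funext x; simp [hb])
    have h : hammingNorm (fun x : Fin m → ZMod 2 => 0 ⬝ᵥ x + b) = 2 ^ m := by
      simp [hammingNorm, hb]
    rw [h]
    exact Nat.pow_le_pow_right (by norm_num) (Nat.sub_le m 1)
  · exact (hammingNorm_affine hm ha b).ge

theorem signSum_quadratic_eq_or (hm : 2 ≤ m) (hm_even : Even m)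
    {Q : QuadraticForm (ZMod 2) (Fin m → ZMod 2)} (hQ : IsNondegQuadratic Q)
    (a : Fin m → ZMod 2) (b : ZMod 2) :
    signSum (fun x => Q x + a ⬝ᵥ x + b) = 2 * 2 ^ (m / 2 - 1) ∨
      signSum (fun x => Q x + a ⬝ᵥ x + b) = 2 * -2 ^ (m / 2 - 1) := by
  rw [mul_neg]
  refine sq_eq_sq_iff_eq_or_eq_neg.1 ?_
  rw [signSum_add_const, mul_pow, signSum_quadratic_sq hQ, ← pow_succ', ← pow_mul]
  -- Evenness of `m` makes `2 ^ m` a perfect square, which fixes the sign sum up to sign.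
  have h : (m / 2 - 1 + 1) * 2 = m := by have := Nat.even_iff.1 hm_even; omega
  rw [h]
  rcases bitSign_eq_or b with hb | hb <;> simp [hb]

theorem le_hammingNorm_quadratic (hm : 2 ≤ m) (hm_even : Even m)
    {Q : QuadraticForm (ZMod 2) (Fin m → ZMod 2)} (hQ : IsNondegQuadratic Q)
    (a : Fin m → ZMod 2) (b : ZMod 2) :
    2 ^ (m - 1) - 2 ^ (m / 2 - 1) ≤ hammingNorm (fun x => Q x + a ⬝ᵥ x + b) := by
  rw [tsub_le_iff_right]
  zify
  have hpos : (0 : ℤ) < 2 ^ (m / 2 - 1) := by positivity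
  rcases signSum_quadratic_eq_or hm hm_even hQ a b with h | h <;>
    have := hammingNorm_of_signSum (by omega) h <;> linarith

theorem exists_hammingNorm_quadratic (hm : 2 ≤ m) (hm_even : Even m)
    {Q : QuadraticForm (ZMod 2) (Fin m → ZMod 2)} (hQ : IsNondegQuadratic Q)
    (a : Fin m → ZMod 2) :
    ∃ b : ZMod 2,
      hammingNorm (fun x => Q x + a ⬝ᵥ x + b) = 2 ^ (m - 1) - 2 ^ (m / 2 - 1) := by
  have hb : ∃ b : ZMod 2, signSum (fun x => Q x + a ⬝ᵥ x + b) = 2 * 2 ^ (m / 2 - 1) := by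
    rcases signSum_quadratic_eq_or hm hm_even hQ a 0 with h | h
    · exact ⟨0, h⟩
    -- Adding the constant `1` flips the sign sum, so the smaller weight is always reached.
    · refine ⟨1, ?_⟩
      simp only [add_zero] at h
      rw [signSum_add_const, h, bitSign_one]
      ring
  obtain ⟨b, hb⟩ := hb
  have h := hammingNorm_of_signSum (by omega) hb
  refine ⟨b, ?_⟩
  rw [eq_tsub_iff_add_eq_of_le (Nat.pow_le_pow_right (by norm_num) (by omega))]
  zify
  linarith

theorem hammingDist_eq_hammingNorm_add {α : Type*} [Fintype α] (f g : α → ZMod 2) :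
    hammingDist f g = hammingNorm (f + g) := by
  have hf : -f = f := funext fun x => CharTwo.neg_eq (f x)
  rw [hammingDist_eq_hammingNorm, hf]

end Bent

/-! ### Size and minimum distance of the Kerdock support -/

section Kerdock

variable {m : ℕ}

theorem kerdock_word_add (Q Q' : QuadraticForm (ZMod 2) (Fin m → ZMod 2))
    (a a' : Fin m → ZMod 2) (b b' : ZMod 2) :
    (fun x => Q x + a ⬝ᵥ x + b) + (fun x => Q' x + a' ⬝ᵥ x + b') =
      fun x => (Q + Q') x + (a + a') ⬝ᵥ x + (b + b') := by
  funext x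
  simp only [Pi.add_apply, _root_.add_apply, add_dotProduct]
  ring

theorem kerdock_word_add_self (Q : QuadraticForm (ZMod 2) (Fin m → ZMod 2))
    (a a' : Fin m → ZMod 2) (b b' : ZMod 2) :
    (fun x => Q x + a ⬝ᵥ x + b) + (fun x => Q x + a' ⬝ᵥ x + b') =
      fun x => (a + a') ⬝ᵥ x + (b + b') := by
  rw [kerdock_word_add]
  funext x
  rw [_root_.add_apply, CharTwo.add_self_eq_zero, zero_add]

theorem affine_injective {a a' : Fin m → ZMod 2} {b b' : ZMod 2}
    (h : ∀ x : Fin m → ZMod 2, a ⬝ᵥ x + b = a' ⬝ᵥ x + b') : a = a' ∧ b = b' := by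
  have hb : b = b' := by simpa using h 0
  refine ⟨funext fun i => ?_, hb⟩
  simpa [hb] using h (Pi.single i 1)

theorem kerdock_le_hammingDist (hm : 2 ≤ m) (hm_even : Even m)
    {𝒬 : Set (QuadraticForm (ZMod 2) (Fin m → ZMod 2))} (h𝒬 : IsKerdockSet 𝒬)
    {f g : (Fin m → ZMod 2) → ZMod 2} (hf : f ∈ kerdockSupport 𝒬) (hg : g ∈ kerdockSupport 𝒬)
    (hfg : f ≠ g) : 2 ^ (m - 1) - 2 ^ (m / 2 - 1) ≤ hammingDist f g := by
  obtain ⟨Q, hQ, a, b, rfl⟩ := hf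
  obtain ⟨Q', hQ', a', b', rfl⟩ := hg
  by_cases h : Q = Q'
  · subst h
    have h0 := hammingDist_ne_zero.2 hfg
    rw [hammingDist_eq_hammingNorm_add, kerdock_word_add_self] at h0 ⊢
    exact (Nat.sub_le _ _).trans
      (pow_le_hammingNorm_affine (by omega) (hammingNorm_ne_zero_iff.1 h0))
  · rw [hammingDist_eq_hammingNorm_add, kerdock_word_add]
    exact le_hammingNorm_quadratic hm hm_even (h𝒬.2 Q hQ Q' hQ' h) _ _

/-- The zero function has sign sum `2 ^ m`, which exceeds `2 ^ (m / 2)`. -/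
theorem ne_zero_of_isNondegQuadratic (hm : 2 ≤ m) (hm_even : Even m)
    {Q : QuadraticForm (ZMod 2) (Fin m → ZMod 2)} (hQ : IsNondegQuadratic Q)
    (a : Fin m → ZMod 2) (b : ZMod 2) : (fun x => Q x + a ⬝ᵥ x + b) ≠ 0 := by
  intro h
  have h4 := signSum_quadratic_eq_or hm hm_even hQ a b
  have h0 : signSum (0 : (Fin m → ZMod 2) → ZMod 2) = 2 ^ m := by simp [signSum]
  rw [h, h0] at h4
  have hlt : (2 : ℤ) * 2 ^ (m / 2 - 1) < 2 ^ m := by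
    rw [← pow_succ']
    exact pow_lt_pow_right₀ (by norm_num) (by omega)
  have hpos : (0 : ℤ) < 2 ^ (m / 2 - 1) := by positivity
  rcases h4 with h4 | h4 <;> linarith

theorem ncard_kerdockSupport (hm : 2 ≤ m) (hm_even : Even m)
    {𝒬 : Set (QuadraticForm (ZMod 2) (Fin m → ZMod 2))} (h𝒬 : IsKerdockSet 𝒬) :
    (kerdockSupport 𝒬).ncard = 2 ^ (2 * m) := by
  let word : QuadraticForm (ZMod 2) (Fin m → ZMod 2) × (Fin m → ZMod 2) × ZMod 2 →
      (Fin m → ZMod 2) → ZMod 2 := fun p x => p.1 x + p.2.1 ⬝ᵥ x + p.2.2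
  have himage : kerdockSupport 𝒬 = word '' (𝒬 ×ˢ Set.univ) := by
    ext f
    constructor
    · rintro ⟨Q, hQ, a, b, rfl⟩
      exact ⟨(Q, a, b), ⟨hQ, trivial⟩, rfl⟩
    · rintro ⟨⟨Q, a, b⟩, ⟨hQ, -⟩, rfl⟩
      exact ⟨Q, hQ, a, b, rfl⟩
  have hinj : Set.InjOn word (𝒬 ×ˢ Set.univ) := by
    rintro ⟨Q, a, b⟩ ⟨hQ, -⟩ ⟨Q', a', b'⟩ ⟨hQ', -⟩ h
    have hQQ' : Q = Q' := by
      by_contra hne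
      refine ne_zero_of_isNondegQuadratic hm hm_even (h𝒬.2 Q hQ Q' hQ' hne) (a + a') (b + b') ?_
      rw [← kerdock_word_add]
      change word (Q, a, b) + word (Q', a', b') = 0
      rw [h, zmod_two_add_self_fun]
    subst hQQ'
    obtain ⟨rfl, rfl⟩ := affine_injective (a := a) (a' := a') (b := b) (b' := b') fun x => by
      have := congrFun h x
      simpa only [word, add_assoc, add_right_inj] using this
    rfl
  rw [himage, hinj.ncard_image, Set.ncard_prod, h𝒬.1, Set.ncard_univ]
  simp only [Nat.card_eq_fintype_card, Fintype.card_prod, Fintype.card_pi, ZMod.card,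
    Finset.prod_const, Finset.card_univ, Fintype.card_fin]
  rw [← pow_succ, ← pow_add]
  congr 1
  omega

theorem isMinDist_kerdockSupport (hm : 2 ≤ m) (hm_even : Even m)
    {𝒬 : Set (QuadraticForm (ZMod 2) (Fin m → ZMod 2))} (h𝒬 : IsKerdockSet 𝒬) :
    IsMinDist (kerdockSupport 𝒬) (2 ^ (m - 1) - 2 ^ (m / 2 - 1)) := by
  constructor
  -- The bound `2 ≤ m` provides two distinct forms, whose bent sum attains the distance.
  · have hcard : 1 < 𝒬.ncard := by rw [h𝒬.1]; exact Nat.one_lt_two_pow (by omega)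
    obtain ⟨Q, Q', hQ, hQ', hne⟩ :=
      Set.one_lt_ncard_iff (Set.finite_of_ncard_pos (by omega)) |>.1 hcard
    have hnd := h𝒬.2 Q hQ Q' hQ' hne
    obtain ⟨b, hb⟩ := exists_hammingNorm_quadratic hm hm_even hnd 0
    have hsum := kerdock_word_add Q Q' 0 0 b 0
    rw [add_zero, add_zero] at hsum
    refine ⟨_, ⟨Q, hQ, 0, b, rfl⟩, _, ⟨Q', hQ', 0, 0, rfl⟩, fun h => ?_, ?_⟩
    · refine ne_zero_of_isNondegQuadratic hm hm_even hnd 0 b ?_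
      rw [← hsum, h, zmod_two_add_self_fun]
    · rw [hammingDist_eq_hammingNorm_add, hsum, hb]
  · rintro _ ⟨f, hf, g, hg, hfg, rfl⟩
    exact kerdock_le_hammingDist hm hm_even h𝒬 hf hg hfg

end Kerdock

/-! ### The first-order Reed–Muller code -/

section ReedMuller

variable (m : ℕ)

/-- The linear parametrisation of the first-order Reed-Muller code by affine functions. -/
def affineWord : ((Fin m → ZMod 2) × ZMod 2) →ₗ[ZMod 2] ((Fin m → ZMod 2) → ZMod 2) where
  toFun p x := p.1 ⬝ᵥ x + p.2
  map_add' p q := by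
    funext x; simp only [Prod.fst_add, Prod.snd_add, add_dotProduct, Pi.add_apply]; ring
  map_smul' c p := by
    funext x
    simp only [Prod.smul_fst, Prod.smul_snd, smul_dotProduct, Pi.smul_apply, smul_eq_mul,
      RingHom.id_apply]
    ring

theorem affineWord_injective : Function.Injective (affineWord m) := by
  rintro ⟨a, b⟩ ⟨a', b'⟩ h
  obtain ⟨rfl, rfl⟩ := affine_injective fun x => congrFun h x
  rfl

theorem range_affineWord : LinearMap.range (affineWord m) = reedMullerOne m := by
  apply le_antisymm
  · rintro _ ⟨⟨a, b⟩, rfl⟩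
    have h : affineWord m (a, b) =
        ∑ i, a i • (fun x : Fin m → ZMod 2 => x i) + b • (fun _ => 1) := by
      funext x
      simp [affineWord, dotProduct]
    rw [h]
    refine add_mem (sum_mem fun i _ => Submodule.smul_mem _ _ (Submodule.subset_span ?_))
      (Submodule.smul_mem _ _ (Submodule.subset_span (Set.mem_insert _ _)))
    exact Set.mem_insert_of_mem _ ⟨i, rfl⟩
  · refine Submodule.span_le.2 (Set.insert_subset ?_ ?_)
    · exact ⟨(0, 1), by funext x; simp [affineWord]⟩
    · rintro _ ⟨i, rfl⟩
      exact ⟨(Pi.single i 1, 0), by funext x; simp [affineWord]⟩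

theorem finrank_reedMullerOne : Module.finrank (ZMod 2) (reedMullerOne m) = m + 1 := by
  rw [← range_affineWord, LinearMap.finrank_range_of_inj (affineWord_injective m)]
  simp

theorem ncard_reedMullerOne :
    (reedMullerOne m : Set ((Fin m → ZMod 2) → ZMod 2)).ncard = 2 ^ (m + 1) := by
  rw [← range_affineWord, LinearMap.coe_range, ← Set.image_univ,
    Set.ncard_image_of_injective _ (affineWord_injective m), Set.ncard_univ]
  simp [pow_succ]

theorem isMinDist_reedMullerOne (hm : 1 ≤ m) :
    IsMinDist (reedMullerOne m : Set ((Fin m → ZMod 2) → ZMod 2)) (2 ^ (m - 1)) := by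
  rw [← range_affineWord]
  constructor
  · have ha : (fun _ : Fin m => (1 : ZMod 2)) ≠ 0 := fun h => by
      simpa using congrFun h ⟨0, hm⟩
    have hd : hammingDist (affineWord m (fun _ => 1, 0)) 0 = 2 ^ (m - 1) := by
      rw [hammingDist_zero_right]
      exact hammingNorm_affine hm ha 0
    exact ⟨_, ⟨_, rfl⟩, 0, zero_mem _,
      hammingDist_ne_zero.1 (by rw [hd]; positivity), hd⟩
  · rintro _ ⟨_, ⟨p, rfl⟩, _, ⟨q, rfl⟩, hne, rfl⟩
    have h0 := hammingDist_ne_zero.2 hne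
    rw [hammingDist_eq_hammingNorm_add, ← map_add] at h0 ⊢
    exact pow_le_hammingNorm_affine hm (hammingNorm_ne_zero_iff.1 h0)

end ReedMuller

/-! ### Construction of a Kerdock set from the trace form -/

section ExistenceOfKerdockSets

open LinearMap (BilinForm)

/-- The quadratic form `∑ i < j, B i j * x i * x j`, for `B` a bilinear form. -/
noncomputable def upperQuadraticForm {m : ℕ} (B : BilinForm (ZMod 2) (Fin m → ZMod 2)) :
    QuadraticForm (ZMod 2) (Fin m → ZMod 2) :=
  (Matrix.toBilin' (Matrix.of fun i j : Fin m =>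
    if i < j then B (Pi.single i 1) (Pi.single j 1) else 0)).toQuadraticMap

theorem upperQuadraticForm_zero {m : ℕ} :
    upperQuadraticForm (0 : BilinForm _ (Fin m → ZMod 2)) = 0 := by
  have : (Matrix.of fun i j : Fin m => if i < j then
      (0 : BilinForm (ZMod 2) (Fin m → ZMod 2)) (Pi.single i 1) (Pi.single j 1) else 0) = 0 := by
    ext; simp
  rw [upperQuadraticForm, this, map_zero, LinearMap.BilinMap.toQuadraticMap_zero]

/-- The polar form of a triangular matrix `M` is `M + Mᵀ`, which rebuilds an alternating form from
its strict upper half; using all of `B` would give polar form `2B = 0`. -/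
theorem polarBilin_upperQuadraticForm {m : ℕ} {B : BilinForm (ZMod 2) (Fin m → ZMod 2)}
    (hB : B.IsAlt) : QuadraticMap.polarBilin (upperQuadraticForm B) = B := by
  rw [upperQuadraticForm, LinearMap.BilinMap.polarBilin_toQuadraticMap]
  refine (Pi.basisFun (ZMod 2) (Fin m)).ext fun i => (Pi.basisFun (ZMod 2) (Fin m)).ext fun j => ?_
  simp only [Pi.basisFun_apply, LinearMap.add_apply, LinearMap.flip_apply,
    Matrix.toBilin'_single, Matrix.of_apply]
  rcases lt_trichotomy i j with h | h | h
  · simp [h, h.not_gt]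
  · subst h; simp [hB.self_eq_zero]
  · simp only [h, h.not_gt, if_false, if_true, zero_add]
    rw [← hB.neg_eq, CharTwo.neg_eq]

variable (K : Type*) [Field K] [Algebra (ZMod 2) K]

theorem charTwo_of_algebra : CharP K 2 := charP_of_injective_algebraMap' (ZMod 2) 2

/-- The alternating forms on `K × 𝔽₂` whose associated quadratic forms make up the Kerdock set:
`((x, e), (y, d)) ↦ Tr (a x) Tr (a y) + Tr (a² x y) + e Tr (a y) + d Tr (a x)`. -/
noncomputable def kerdockBilin (a : K) : BilinForm (ZMod 2) (K × ZMod 2) :=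
  LinearMap.mk₂ (ZMod 2)
    (fun v w => Algebra.trace (ZMod 2) K (a * v.1) * Algebra.trace (ZMod 2) K (a * w.1) +
      Algebra.trace (ZMod 2) K ((a * v.1) * (a * w.1)) +
      v.2 * Algebra.trace (ZMod 2) K (a * w.1) + w.2 * Algebra.trace (ZMod 2) K (a * v.1))
    (by intro u v w; simp [mul_add, add_mul]; ring)
    (by intro c v w; simp; ring)
    (by intro u v w; simp [mul_add, add_mul]; ring)
    (by intro c v w; simp; ring)

variable {K}

theorem kerdockBilin_apply (a : K) (v w : K × ZMod 2) :
    kerdockBilin K a v w =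
      Algebra.trace (ZMod 2) K (a * v.1) * Algebra.trace (ZMod 2) K (a * w.1) +
      Algebra.trace (ZMod 2) K ((a * v.1) * (a * w.1)) +
      v.2 * Algebra.trace (ZMod 2) K (a * w.1) + w.2 * Algebra.trace (ZMod 2) K (a * v.1) := rfl

theorem kerdockBilin_zero : kerdockBilin K 0 = 0 := by
  refine LinearMap.ext₂ fun v w => ?_
  simp [kerdockBilin_apply]

theorem zmod_two_mul_self (c : ZMod 2) : c * c = c := by revert c; decide

variable [Finite K]

theorem trace_sq_zmod_two (x : K) :
    Algebra.trace (ZMod 2) K (x ^ 2) = Algebra.trace (ZMod 2) K x := by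
  have : Algebra.IsAlgebraic (ZMod 2) K := inferInstance
  have h := Algebra.trace_eq_of_algEquiv (FiniteField.frobeniusAlgEquivOfAlgebraic (ZMod 2) K) x
  simpa using h

theorem kerdockBilin_isAlt (a : K) : (kerdockBilin K a).IsAlt := by
  intro v
  rw [kerdockBilin_apply, ← sq (a * v.1), trace_sq_zmod_two, zmod_two_mul_self]
  linear_combination (Algebra.trace (ZMod 2) K (a * v.1) +
    v.2 * Algebra.trace (ZMod 2) K (a * v.1)) * CharTwo.two_eq_zero (R := ZMod 2)

/-- Pairing `(x, e)` with `(0, 1)` gives `Tr (a x) = Tr (c x) = τ`; pairing with all `(y, 0)` gives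
`(a + c) x = τ + e` by nondegeneracy of the trace form. The left side has trace `τ + τ = 0`, while
in odd degree the scalar on the right is its own trace. So `τ + e = 0`, whence `x = 0` and `e = 0`.
-/
theorem eq_zero_of_kerdockBilin_add_eq_zero (hK : Odd (Module.finrank (ZMod 2) K)) {a c : K}
    (hac : a ≠ c) {v : K × ZMod 2}
    (hv : ∀ w, (kerdockBilin K a + kerdockBilin K c) v w = 0) : v = 0 := by
  have : CharP K 2 := charTwo_of_algebra K
  obtain ⟨x, e⟩ := v
  set T := Algebra.trace (ZMod 2) K with hT
  have hac' : a + c ≠ 0 := fun h => hac (CharTwo.add_eq_zero.1 h)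
  have hτ : T (a * x) = T (c * x) := by
    have h := hv (0, 1)
    simp only [LinearMap.add_apply, kerdockBilin_apply, mul_zero, map_zero, zero_add, one_mul] at h
    exact CharTwo.add_eq_zero.1 h
  set τ := T (a * x) with hτ'
  have hy : ∀ y : K, T (((algebraMap (ZMod 2) K (τ + e)) * (a + c) + (a + c) ^ 2 * x) * y) = 0 := by
    intro y
    have h := hv (y, 0)
    simp only [LinearMap.add_apply, kerdockBilin_apply, zero_mul, add_zero, ← hT, ← hτ, ← hτ'] at h
    have h1 : (algebraMap (ZMod 2) K (τ + e) * (a + c) + (a + c) ^ 2 * x) * y =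
        (τ + e) • (a * y) + (τ + e) • (c * y) + (a * x * (a * y) + c * x * (c * y)) := by
      rw [Algebra.smul_def, Algebra.smul_def, CharTwo.add_sq]
      ring
    rw [h1, map_add, map_add, map_add, map_smul, map_smul, smul_eq_mul, smul_eq_mul, ← h]
    ring
  have h0 : algebraMap (ZMod 2) K (τ + e) * (a + c) + (a + c) ^ 2 * x = 0 :=
    (traceForm_nondegenerate (ZMod 2) K).1 _ fun y => hy y
  have h1 : (a + c) * x = algebraMap (ZMod 2) K (τ + e) := by
    have h2 : (a + c) * (algebraMap (ZMod 2) K (τ + e) + (a + c) * x) = 0 := by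
      rw [← h0]; ring
    exact (CharTwo.add_eq_zero.1 ((mul_eq_zero.1 h2).resolve_left hac')).symm
  have h2 : τ + e = 0 := by
    have h3 := congrArg T h1
    rw [hT, Algebra.trace_algebraMap, ← hT, add_mul, map_add, ← hτ, CharTwo.add_self_eq_zero,
      nsmul_eq_mul, (ZMod.natCast_eq_one_iff_odd).2 hK, one_mul] at h3
    exact h3.symm
  have hx : x = 0 := by
    rw [h2, map_zero] at h1
    exact (mul_eq_zero.1 h1).resolve_left hac'
  have he : e = 0 := by
    rw [hτ', hx, mul_zero, map_zero, zero_add] at h2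
    exact h2
  rw [hx, he]; rfl

theorem exists_isKerdockSet {m : ℕ} (hm : 2 ≤ m) (hm_even : Even m) :
    ∃ 𝒬 : Set (QuadraticForm (ZMod 2) (Fin m → ZMod 2)), IsKerdockSet 𝒬 ∧ 0 ∈ 𝒬 := by
  let K := GaloisField 2 (m - 1)
  have hfin : Module.finrank (ZMod 2) K = m - 1 := GaloisField.finrank 2 (by omega)
  have hodd : Odd (Module.finrank (ZMod 2) K) := by
    rw [hfin]; exact Nat.Even.sub_odd (by omega) hm_even odd_one
  have hdim : Module.finrank (ZMod 2) (Fin m → ZMod 2) = Module.finrank (ZMod 2) (K × ZMod 2) := by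
    rw [Module.finrank_prod, hfin, Module.finrank_self, Module.finrank_fin_fun]; omega
  let φ : (Fin m → ZMod 2) ≃ₗ[ZMod 2] (K × ZMod 2) := LinearEquiv.ofFinrankEq _ _ hdim
  let B : K → BilinForm (ZMod 2) (Fin m → ZMod 2) := fun a =>
    (kerdockBilin K a).compl₁₂ φ.toLinearMap φ.toLinearMap
  have hB : ∀ a, (B a).IsAlt := fun a v => kerdockBilin_isAlt a (φ v)
  let q : K → QuadraticForm (ZMod 2) (Fin m → ZMod 2) := fun a => upperQuadraticForm (B a)
  have hq : ∀ a c, a ≠ c → IsNondegQuadratic (q a + q c) := by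
    intro a c hac
    have hpol : QuadraticMap.polarBilin (q a + q c) = B a + B c := by
      rw [← polarBilin_upperQuadraticForm (hB a), ← polarBilin_upperQuadraticForm (hB c)]
      refine LinearMap.ext₂ fun x y => ?_
      simp only [LinearMap.add_apply, QuadraticMap.polarBilin_apply_apply, QuadraticMap.polar,
        _root_.add_apply, q]
      ring
    have hleft : ∀ v, (∀ w, (B a + B c) v w = 0) → v = 0 := by
      intro v hv
      refine φ.map_eq_zero_iff.1 (eq_zero_of_kerdockBilin_add_eq_zero hodd hac fun w => ?_)
      simpa [B] using hv (φ.symm w)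
    rw [IsNondegQuadratic, hpol]
    -- Alternation turns left nondegeneracy into right nondegeneracy.
    refine ⟨hleft, fun w hw => hleft w fun v => ?_⟩
    have halt : (B a + B c).IsAlt := (hB a).add (hB c)
    rw [← halt.neg_eq, hw v, neg_zero]
  have : Nontrivial (Fin m → ZMod 2) := by
    have : Nonempty (Fin m) := ⟨⟨0, by omega⟩⟩
    infer_instance
  -- Two equal forms would sum to `0`, whose polar form is degenerate; hence the family has exactly
  -- `2 ^ (m - 1)` members.
  have hinj : Function.Injective q := by
    intro a c h
    by_contra hac
    have h1 := hq a c hac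
    rw [h, show q c + q c = 0 from QuadraticMap.ext fun x => CharTwo.add_self_eq_zero (q c x)] at h1
    have h0 : QuadraticMap.polarBilin (0 : QuadraticForm (ZMod 2) (Fin m → ZMod 2)) = 0 :=
      LinearMap.ext₂ fun x y => by simp [QuadraticMap.polar]
    rw [IsNondegQuadratic, h0] at h1
    exact LinearMap.BilinForm.not_nondegenerate_zero (ZMod 2) (Fin m → ZMod 2) h1
  refine ⟨Set.range q, ⟨?_, ?_⟩, 0, ?_⟩
  · rw [← Set.image_univ, Set.ncard_image_of_injective _ hinj, Set.ncard_univ,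
      GaloisField.card 2 (m - 1) (by omega)]
  · rintro _ ⟨a, rfl⟩ _ ⟨c, rfl⟩ h
    exact hq a c fun hac => h (by rw [hac])
  · have h0 : B 0 = 0 := by
      simp only [B, kerdockBilin_zero]; rfl
    simp only [q, h0, upperQuadraticForm_zero]

end ExistenceOfKerdockSets

theorem mainTheorem6 (m : ℕ) (hm : 2 ≤ m) (hm_even : Even m) :
    -- Kerdock sets exist, even with the zero form as a member
    (∃ 𝒬 : Set (QuadraticForm (ZMod 2) (Fin m → ZMod 2)), IsKerdockSet 𝒬 ∧ 0 ∈ 𝒬) ∧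
    -- size, minimum distance and Fourier-support code of the Kerdock-type support
    (∀ 𝒬 : Set (QuadraticForm (ZMod 2) (Fin m → ZMod 2)), IsKerdockSet 𝒬 →
      (kerdockSupport 𝒬).ncard = 2 ^ (2 * m) ∧
      IsMinDist (kerdockSupport 𝒬) (2 ^ (m - 1) - 2 ^ (m / 2 - 1)) ∧
      Module.finrank ℂ (fourierCode (kerdockSupport 𝒬)) = 2 ^ (2 * m) ∧
      ∀ t : ℕ, 2 * t + 1 ≤ 2 ^ (m - 1) - 2 ^ (m / 2 - 1) →
        ExactlyCorrects (fourierCode (kerdockSupport 𝒬))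
          (localPhaseErrors (Fin m → ZMod 2) t)) ∧
    -- comparison with the first-order Reed-Muller code
    (Module.finrank (ZMod 2) (reedMullerOne m) = m + 1 ∧
      (reedMullerOne m : Set ((Fin m → ZMod 2) → ZMod 2)).ncard = 2 ^ (m + 1) ∧
      IsMinDist (reedMullerOne m : Set ((Fin m → ZMod 2) → ZMod 2)) (2 ^ (m - 1)) ∧
      Module.finrank ℂ
        (fourierCode (reedMullerOne m : Set ((Fin m → ZMod 2) → ZMod 2))) = 2 ^ (m + 1) ∧
      ∀ t : ℕ, 2 * t + 1 ≤ 2 ^ (m - 1) →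
        ExactlyCorrects (fourierCode (reedMullerOne m : Set ((Fin m → ZMod 2) → ZMod 2)))
          (localPhaseErrors (Fin m → ZMod 2) t)) := by
  refine ⟨exists_isKerdockSet hm hm_even, fun 𝒬 h𝒬 => ?_, finrank_reedMullerOne m,
    ncard_reedMullerOne m, isMinDist_reedMullerOne m (by omega), ?_, fun t ht => ?_⟩
  · have hd := isMinDist_kerdockSupport hm hm_even h𝒬
    refine ⟨ncard_kerdockSupport hm hm_even h𝒬, hd, ?_, fun t ht => ?_⟩
    · rw [finrank_fourierCode, ncard_kerdockSupport hm hm_even h𝒬]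
    · exact exactlyCorrects_localPhaseErrors hd ht
  · rw [finrank_fourierCode, ncard_reedMullerOne]
  · exact exactlyCorrects_localPhaseErrors (isMinDist_reedMullerOne m (by omega)) ht
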